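/- All rings are commutative with identity and need not be Noetherian; all modules are unital. Let $R$ be a ring, $M$ an $R$-module and $\mathbf x=x_1,\dots,x_\ell$ a finite sequence in $R$. The sequence $\mathbf x$ is $M$-regular if $x_i$ is a non-zero-divisor on $M/(x_1,\dots,x_{i-1})M$ for $i=1,\dots,\ell$ and $\mathbf xM\neq M$. For $m\ge n$ let $\varphi^m_n\colon \mathbb K_\bullet(\mathbf x^m,M)\to\mathbb K_\bullet(\mathbf x^n,M)$ be the tensor product over $j$ of the chain maps of Koszul complexes $\mathbb K_\bullet(x_j^m)\to\mathbb K_\bullet(x_j^n)$ that are multiplication by $x_j^{m-n}$ in degree $1$ and the identity in degree $0$. The sequence $\mathbf x$ is $M$-weakly proregular if for each $n$ there is $m\ge n$ such that $\varphi^m_n$ induces the zero map $H_i(\mathbf x^m,M)\to H_i(\mathbf x^n,M)$ on Koszul homology for all $i\ge1$. It is a parameter sequence on $M$ if it is $M$-weakly proregular, $\mathbf xM\ne M$, and $H^{\ell}_{\mathbf x}(M)_{\mathfrak p}\neq0$ for every prime $\mathfrak p\in\operatorname{Supp}_R(M/\mathbf xM)$, where $H^i_{\mathbf x}(M)$ is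 the $i$-th cohomology of the Čech complex of $M$ with respect to $\mathbf x$. It is a strong parameter sequence on $M$ if $x_1,\dots,x_i$ is a parameter sequence on $M$ for $i=1,\dots,\ell$. By convention the empty sequence is a (strong) parameter sequence and a regular sequence on every module. The module $M$ is Cohen–Macaulay if every strong parameter sequence on $M$ is an $M$-regular sequence; a ring is Cohen–Macaulay if it is so as a module over itself. **Proposition.** Let $R$ and $S$ be commutative rings, $J$ an ideal of $S$ and $f\colon R\to S$ a ring homomorphism. Regard $J$ as an $R$-module through $f$, and let $R\bowtie^fJ=\{(r,f(r)+j): r\in R,\ j\in J\}\subseteq R\times S$ be the amalgamation of $R$ with $S$ along $J$ with respect to $f$. Assume that $J$ is flat over $R$ and that the ring $R\bowtie^fJ$ is Cohen–Macaulay. Then $R$ is Cohen–Macaulay. If, moreover, every strong parameter sequence (of elements of $R$) on $J$ is a strong parameter sequence on $R$, then $J$ is a Cohen–Macaulay $R$-module. -/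

import Mathlib

namespace NonNoethCM

universe u v

section Koszul

variable {R : Type u} [CommRing R] {ℓ : ℕ} (x : Fin ℓ → R) (M : Type v) [AddCommGroup M] [Module R M]

/-- The sign `(-1) ^ #{k ∈ s | k < j}` attached to an index `j` and a set of indices `s`. -/
def sgn (R : Type u) [CommRing R] {ℓ : ℕ} (s : Finset (Fin ℓ)) (j : Fin ℓ) : R := (-1) ^ (s.filter (· < j)).card

/-- The differential of the (total) Koszul complex `K(x₁, M) ⊗ ⋯ ⊗ K(x_ℓ, M)`.
The module `⨁ᵢ Kᵢ(x, M)` is the module of all families `z` of elements of `M` indexed by the subsets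
`s` of `{1, …, ℓ}` (`z s` is the coefficient of the basis element `e_s`). -/
def koszulD : (Finset (Fin ℓ) → M) →ₗ[R] (Finset (Fin ℓ) → M) where
  toFun z s := ∑ j ∈ sᶜ, sgn R s j • x j • z (insert j s)
  map_add' z w := by
    funext s
    simp [smul_add, Finset.sum_add_distrib]
  map_smul' r z := by
    funext s
    simp only [Pi.smul_apply, RingHom.id_apply, Finset.smul_sum]
    refine Finset.sum_congr rfl fun j _ => ?_
    rw [smul_comm (x j) r, smul_comm (sgn R s j) r]

/-- `Kᵢ(x, M)`: the families supported on the subsets with exactly `i` elements. -/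
def koszulChains (_x : Fin ℓ → R) (i : ℕ) : Submodule R (Finset (Fin ℓ) → M) where
  carrier := {z | ∀ s, s.card ≠ i → z s = 0}
  add_mem' {z w} hz hw s hs := by simp [hz s hs, hw s hs]
  zero_mem' s _ := rfl
  smul_mem' r z hz s hs := by simp [hz s hs]

/-- The `i`-cycles of the Koszul complex. -/
def koszulCycles (i : ℕ) : Submodule R (Finset (Fin ℓ) → M) :=
  koszulChains M x i ⊓ LinearMap.ker (koszulD x M)

/-- The `i`-boundaries of the Koszul complex. -/
def koszulBoundaries (i : ℕ) : Submodule R (Finset (Fin ℓ) → M) :=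
  (koszulChains M x (i + 1)).map (koszulD x M)

theorem sgn_insert (s : Finset (Fin ℓ)) {j k : Fin ℓ} (hj : j ∉ s) :
    sgn R (insert j s) k = if j < k then - sgn R s k else sgn R s k := by
  unfold sgn
  rw [Finset.filter_insert]
  split_ifs with h
  · rw [Finset.card_insert_of_notMem (by simp [hj]), pow_succ, mul_neg_one]
  · rfl

theorem sgn_swap (s : Finset (Fin ℓ)) {j k : Fin ℓ} (hj : j ∉ s) (hk : k ∉ s) (hjk : j ≠ k) :
    sgn R s j * sgn R (insert j s) k + sgn R s k * sgn R (insert k s) j = 0 := by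
  rw [sgn_insert s hj, sgn_insert s hk]
  rcases lt_or_gt_of_ne hjk with h | h
  · rw [if_pos h, if_neg h.not_gt]
    ring
  · rw [if_neg h.not_gt, if_pos h]
    ring

/-- The Koszul differential squares to zero. -/
theorem koszulD_koszulD (z : Finset (Fin ℓ) → M) : koszulD x M (koszulD x M z) = 0 := by
  funext s
  simp only [koszulD, LinearMap.coe_mk, AddHom.coe_mk, Finset.smul_sum, Pi.zero_apply]
  rw [Finset.sum_sigma']
  refine Finset.sum_involution (fun a _ => ⟨a.2, a.1⟩) ?_ ?_ ?_ ?_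
  · rintro ⟨j, k⟩ h
    simp only [Finset.mem_sigma, Finset.mem_compl, Finset.mem_insert, not_or] at h
    dsimp only
    rw [Finset.insert_comm j k s]
    simp only [smul_smul, ← add_smul]
    have hs := sgn_swap (R := R) s h.1 h.2.2 (Ne.symm h.2.1)
    convert zero_smul R (z (insert k (insert j s))) using 2
    linear_combination (x j * x k) * hs
  · rintro ⟨j, k⟩ h _ he
    simp only [Finset.mem_sigma, Finset.mem_compl, Finset.mem_insert, not_or] at h
    simp only [Sigma.mk.injEq, heq_eq_eq] at he
    exact h.2.1 he.1
  · rintro ⟨j, k⟩ h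
    simp only [Finset.mem_sigma, Finset.mem_compl, Finset.mem_insert, not_or] at h ⊢
    exact ⟨h.2.2, Ne.symm h.2.1, h.1⟩
  · rintro ⟨j, k⟩ _
    rfl

theorem koszulBoundaries_le_cycles (i : ℕ) : koszulBoundaries x M i ≤ koszulCycles x M i := by
  rintro _ ⟨w, hw, rfl⟩
  refine ⟨fun s hs => ?_, koszulD_koszulD x M w⟩
  simp only [koszulD, LinearMap.coe_mk, AddHom.coe_mk]
  refine Finset.sum_eq_zero fun j hj => ?_
  rw [hw (insert j s) (by rw [Finset.card_insert_of_notMem (by simpa using hj)]; omega)]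
  simp

/-- The Koszul homology `Hᵢ(x, M)`. -/
abbrev KoszulHomology (i : ℕ) : Type v :=
  koszulCycles x M i ⧸ (koszulBoundaries x M i).submoduleOf (koszulCycles x M i)

/-- The map `φ = φ(x₁, M) ⊗ ⋯ ⊗ φ(x_ℓ, M)` from the Koszul complex of `x₁ᵐ, …, x_ℓᵐ` to that of
`x₁ⁿ, …, x_ℓⁿ`, for `n ≤ m`: on the coefficient of `e_s` it is multiplication by
`∏ j ∈ s, x_j ^ (m - n)`. -/
def koszulPhi (n m : ℕ) : (Finset (Fin ℓ) → M) →ₗ[R] (Finset (Fin ℓ) → M) where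
  toFun z s := (∏ j ∈ s, x j ^ (m - n)) • z s
  map_add' z w := by
    funext s
    simp
  map_smul' r z := by
    funext s
    simp only [Pi.smul_apply, RingHom.id_apply]
    rw [smul_comm]

theorem koszulPhi_comm {n m : ℕ} (h : n ≤ m) (z : Finset (Fin ℓ) → M) :
    koszulD (x ^ n) M (koszulPhi x M n m z) = koszulPhi x M n m (koszulD (x ^ m) M z) := by
  funext s
  simp only [koszulD, koszulPhi, LinearMap.coe_mk, AddHom.coe_mk, Finset.smul_sum, Pi.pow_apply]
  refine Finset.sum_congr rfl fun j hj => ?_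
  rw [Finset.prod_insert (by simpa using hj)]
  simp only [smul_smul]
  congr 1
  rw [← Nat.add_sub_cancel' h, pow_add, Nat.add_sub_cancel_left]
  ring

theorem koszulPhi_mem_cycles {n m : ℕ} (h : n ≤ m) (i : ℕ) (z : Finset (Fin ℓ) → M)
    (hz : z ∈ koszulCycles (x ^ m) M i) : koszulPhi x M n m z ∈ koszulCycles (x ^ n) M i := by
  refine ⟨fun s hs => ?_, ?_⟩
  · have := hz.1 s hs
    simp [koszulPhi, this]
  · have h2 : koszulD (x ^ m) M z = 0 := hz.2
    change koszulD (x ^ n) M (koszulPhi x M n m z) = 0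
    rw [koszulPhi_comm x M h, h2, map_zero]

theorem koszulPhi_mem_boundaries {n m : ℕ} (h : n ≤ m) (i : ℕ) (z : Finset (Fin ℓ) → M)
    (hz : z ∈ koszulBoundaries (x ^ m) M i) :
    koszulPhi x M n m z ∈ koszulBoundaries (x ^ n) M i := by
  obtain ⟨w, hw, rfl⟩ := hz
  refine ⟨koszulPhi x M n m w, fun s hs => ?_, koszulPhi_comm x M h w⟩
  have := hw s hs
  simp [koszulPhi, this]

/-- The map `Hᵢ(xᵐ, M) → Hᵢ(xⁿ, M)` induced by `φ`, for `n ≤ m`. -/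
def koszulHomologyMap {n m : ℕ} (h : n ≤ m) (i : ℕ) :
    KoszulHomology (x ^ m) M i →ₗ[R] KoszulHomology (x ^ n) M i :=
  Submodule.mapQ _ _ ((koszulPhi x M n m).restrict (koszulPhi_mem_cycles x M h i))
    fun z hz => koszulPhi_mem_boundaries x M h i z hz

/-- `x` is an `M`-weakly proregular sequence. -/
def IsWeaklyProregular : Prop :=
  ∀ n : ℕ, ∃ m : ℕ, ∃ h : n ≤ m, ∀ i : ℕ, 1 ≤ i → koszulHomologyMap x M h i = 0

end Koszul

section Cech

variable {R : Type u} [CommRing R] {ℓ : ℕ} (x : Fin ℓ → R) (M : Type v) [AddCommGroup M] [Module R M]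

/-- The localization of `M` at the powers of `∏ j ∈ s, x j`. -/
abbrev CechPiece (s : Finset (Fin ℓ)) : Type (max u v) :=
  LocalizedModule (Submonoid.powers (∏ j ∈ s, x j)) M

theorem isUnit_of_mem_powers {s t : Finset (Fin ℓ)} (h : s ⊆ t)
    (a : Submonoid.powers (∏ j ∈ s, x j)) :
    IsUnit (algebraMap R (Module.End R (CechPiece x M t)) a) := by
  obtain ⟨_, k, rfl⟩ := a
  have hu : IsUnit (algebraMap R (Module.End R (CechPiece x M t)) (∏ j ∈ t, x j)) :=
    IsLocalizedModule.map_units (LocalizedModule.mkLinearMap _ M)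
      (⟨_, Submonoid.mem_powers _⟩ : Submonoid.powers (∏ j ∈ t, x j))
  have he : ∏ j ∈ t, x j = (∏ j ∈ s, x j) * ∏ j ∈ t \ s, x j := by
    rw [← Finset.prod_sdiff h, mul_comm]
  have hu : IsUnit (algebraMap R (Module.End R (CechPiece x M t)) (∏ j ∈ s, x j) *
      algebraMap R (Module.End R (CechPiece x M t)) (∏ j ∈ t \ s, x j)) := by
    rw [← map_mul, ← he]
    exact hu
  have hc : Commute (algebraMap R (Module.End R (CechPiece x M t)) (∏ j ∈ s, x j))
      (algebraMap R (Module.End R (CechPiece x M t)) (∏ j ∈ t \ s, x j)) :=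
    Algebra.commutes _ _
  simpa only [map_pow] using ((hc.isUnit_mul_iff.1 hu).1).pow k

/-- The natural localization map between two such localizations of `M`, for `s ⊆ t`. -/
noncomputable def cechRes {s t : Finset (Fin ℓ)} (h : s ⊆ t) :
    CechPiece x M s →ₗ[R] CechPiece x M t :=
  LocalizedModule.lift (Submonoid.powers (∏ j ∈ s, x j)) (LocalizedModule.mkLinearMap _ M)
    (isUnit_of_mem_powers x M h)

/-- The differential of the (total) Čech complex `C(x₁) ⊗ ⋯ ⊗ C(x_ℓ) ⊗ M`, whose terms are the
localizations of `M` at the products of subfamilies of `x`. -/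
noncomputable def cechD : (∀ s, CechPiece x M s) →ₗ[R] (∀ s, CechPiece x M s) :=
  LinearMap.pi fun t => ∑ j ∈ t,
    sgn R t j • (cechRes x M (t.erase_subset j) ∘ₗ LinearMap.proj (t.erase j))

/-- `Cⁱ(x; M)`: the families supported on the subsets with exactly `i` elements. -/
def cechCochains (i : ℕ) : Submodule R (∀ s, CechPiece x M s) where
  carrier := {c | ∀ s, s.card ≠ i → c s = 0}
  add_mem' {c e} hc he s hs := by simp [hc s hs, he s hs]
  zero_mem' s _ := rfl
  smul_mem' r c hc s hs := by simp [hc s hs]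

/-- The `i`-cocycles of the Čech complex. -/
noncomputable def cechCocycles (i : ℕ) : Submodule R (∀ s, CechPiece x M s) :=
  cechCochains x M i ⊓ LinearMap.ker (cechD x M)

/-- The `i`-coboundaries of the Čech complex. -/
noncomputable def cechCoboundaries : ℕ → Submodule R (∀ s, CechPiece x M s)
  | 0 => ⊥
  | i + 1 => (cechCochains x M i).map (cechD x M)

theorem cechRes_apply_comp {s t t' : Finset (Fin ℓ)} (h : s ⊆ t) (h' : t ⊆ t')
    (c : CechPiece x M s) : cechRes x M h' (cechRes x M h c) = cechRes x M (h.trans h') c := by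
  have hh : cechRes x M h' ∘ₗ cechRes x M h = cechRes x M (h.trans h') := by
    symm
    refine LocalizedModule.lift_unique _ _ (isUnit_of_mem_powers x M (h.trans h')) _ ?_
    unfold cechRes
    rw [LinearMap.comp_assoc, LocalizedModule.lift_comp, LocalizedModule.lift_comp]
  exact LinearMap.congr_fun hh c

theorem cechRes_congr {s s' t : Finset (Fin ℓ)} (e : s = s') (h : s ⊆ t) (h' : s' ⊆ t)
    (c : ∀ s, CechPiece x M s) : cechRes x M h (c s) = cechRes x M h' (c s') := by
  subst e
  rfl

theorem cechD_apply (c : ∀ s, CechPiece x M s) (t : Finset (Fin ℓ)) :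
    cechD x M c t = ∑ j ∈ t, sgn R t j • cechRes x M (t.erase_subset j) (c (t.erase j)) := by
  simp only [cechD, LinearMap.pi_apply, LinearMap.sum_apply]
  rfl

/-- The Čech differential squares to zero. -/
theorem cechD_cechD (c : ∀ s, CechPiece x M s) : cechD x M (cechD x M c) = 0 := by
  funext t
  rw [cechD_apply]
  simp only [cechD_apply, map_sum, map_smul, Finset.smul_sum, cechRes_apply_comp, Pi.zero_apply]
  rw [Finset.sum_sigma']
  refine Finset.sum_involution (fun a _ => ⟨a.2, a.1⟩) ?_ ?_ ?_ ?_
  · rintro ⟨j, k⟩ h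
    simp only [Finset.mem_sigma, Finset.mem_erase] at h
    dsimp only
    obtain ⟨hj, hkj, hk⟩ := h
    rw [cechRes_congr x M (Finset.erase_right_comm (s := t) (a := k) (b := j)) _
      (((t.erase j).erase_subset k).trans (t.erase_subset j)), smul_smul, smul_smul, ← add_smul]
    have h1 : t.erase j = insert k ((t.erase j).erase k) :=
      (Finset.insert_erase (by simp [hkj, hk])).symm
    have h2 : t.erase k = insert j ((t.erase j).erase k) := by
      rw [Finset.erase_right_comm]
      exact (Finset.insert_erase (by simp [Ne.symm hkj, hj])).symm
    have h3 : t = insert j (insert k ((t.erase j).erase k)) := by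
      rw [← h1, Finset.insert_erase hj]
    have hs : sgn R t j * sgn R (t.erase j) k + sgn R t k * sgn R (t.erase k) j = 0 := by
      set s := (t.erase j).erase k with hsdef
      have hjs : j ∉ s := by simp [hsdef]
      have hks : k ∉ s := by simp [hsdef]
      have hjs' : j ∉ insert k s := by simp [hjs, Ne.symm hkj]
      rw [h1, h2, h3, sgn_insert (insert k s) hjs', sgn_insert (insert k s) hjs',
        sgn_insert s hks, sgn_insert s hks, sgn_insert s hjs]
      rcases lt_or_gt_of_ne hkj with hlt | hlt
      · simp [hlt, hlt.not_gt]
        ring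
      · simp [hlt, hlt.not_gt]
        ring
    rw [hs, zero_smul]
  · rintro ⟨j, k⟩ h _ he
    simp only [Finset.mem_sigma, Finset.mem_erase] at h
    simp only [Sigma.mk.injEq, heq_eq_eq] at he
    exact h.2.1 he.1
  · rintro ⟨j, k⟩ h
    simp only [Finset.mem_sigma, Finset.mem_erase] at h ⊢
    exact ⟨h.2.2, Ne.symm h.2.1, h.1⟩
  · rintro ⟨j, k⟩ _
    rfl

theorem cechCoboundaries_le_cocycles (i : ℕ) : cechCoboundaries x M i ≤ cechCocycles x M i := by
  cases i with
  | zero => exact bot_le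
  | succ i =>
    rintro _ ⟨w, hw, rfl⟩
    refine ⟨fun s hs => ?_, cechD_cechD x M w⟩
    rw [cechD_apply]
    refine Finset.sum_eq_zero fun j hj => ?_
    have hc := Finset.card_erase_add_one hj
    rw [hw (s.erase j) (by omega), map_zero, smul_zero]

/-- The Čech cohomology `Hⁱₓ(M)`. -/
abbrev CechCohomology (i : ℕ) : Type (max u v) :=
  cechCocycles x M i ⧸ (cechCoboundaries x M i).submoduleOf (cechCocycles x M i)

end Cech

section CohenMacaulay

variable {R : Type u} [CommRing R] (M : Type v) [AddCommGroup M] [Module R M]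

/-- `x` is a parameter sequence on `M`; by convention the empty sequence always is one. -/
def IsParameterSequence (x : List R) : Prop :=
  x = [] ∨
    (IsWeaklyProregular x.get M ∧
      (Ideal.ofList x • ⊤ : Submodule R M) ≠ ⊤ ∧
      ∀ p ∈ Module.support R (M ⧸ (Ideal.ofList x • ⊤ : Submodule R M)),
        Nontrivial (LocalizedModule p.asIdeal.primeCompl (CechCohomology x.get M x.length)))

/-- `x` is a strong parameter sequence on `M`. -/
def IsStrongParameterSequence (x : List R) : Prop :=
  ∀ i : ℕ, 1 ≤ i → i ≤ x.length → IsParameterSequence M (x.take i)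

/-- `x` is an `M`-regular sequence; by convention the empty sequence always is one, even on the
zero module. -/
def IsRegularSequence (x : List R) : Prop :=
  x = [] ∨ RingTheory.Sequence.IsRegular M x

variable (R) in
/-- Cohen-Macaulay modules over an arbitrary commutative ring. -/
def IsCohenMacaulayModule : Prop :=
  ∀ x : List R, IsStrongParameterSequence M x → IsRegularSequence M x

/-- Cohen-Macaulay rings. -/
def IsCohenMacaulayRing (A : Type u) [CommRing A] : Prop := IsCohenMacaulayModule A A

end CohenMacaulay

/-- The amalgamation `R ⋈^f J` of `R` with `S` along `J` with respect to `f`, as a subring of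
`R × S`. -/
def amalgamation {R : Type u} {S : Type v} [CommRing R] [CommRing S] (f : R →+* S) (J : Ideal S) :
    Subring (R × S) where
  carrier := {a | ∃ r : R, ∃ j ∈ J, a = (r, f r + j)}
  mul_mem' := by
    rintro _ _ ⟨r, j, hj, rfl⟩ ⟨r', j', hj', rfl⟩
    refine ⟨r * r', f r * j' + j * f r' + j * j', ?_, ?_⟩
    · exact J.add_mem (J.add_mem (J.mul_mem_left _ hj') (J.mul_mem_right _ hj))
        (J.mul_mem_left _ hj')
    · ext
      · rfl
      · simp only [Prod.mk_mul_mk, map_mul]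
        ring
  one_mem' := ⟨1, 0, J.zero_mem, by simp [Prod.ext_iff]⟩
  add_mem' := by
    rintro _ _ ⟨r, j, hj, rfl⟩ ⟨r', j', hj', rfl⟩
    refine ⟨r + r', j + j', J.add_mem hj hj', ?_⟩
    ext
    · rfl
    · simp only [Prod.mk_add_mk, map_add]
      ring
  zero_mem' := ⟨0, 0, J.zero_mem, by simp [Prod.ext_iff]⟩
  neg_mem' := by
    rintro _ ⟨r, j, hj, rfl⟩
    refine ⟨-r, -j, J.neg_mem hj, ?_⟩
    ext
    · rfl
    · simp only [Prod.neg_mk, map_neg]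
      ring

end NonNoethCM

/-!
As an `R`-module, `A = R ⋈^f J` is `R ⊕ J`, so it is faithfully flat over `R` when `J` is flat.
Strong parameter sequences on `R` remain so on a faithfully flat `R`-algebra `A`. Indeed, Koszul
cycles with coefficients in a flat module are sums of images of Koszul cycles with coefficients in
`R`, so weak proregularity ascends. Next, every class in the top Čech cohomology is a multiple of a
class `1 / (x₁ ⋯ x_ℓ) ^ n`, so that this cohomology is nonzero at a prime exactly when the prime
contains the annihilator of one of these classes; by flatness, these annihilators extend to those
over `A`. As `A` is Cohen–Macaulay, a strong parameter sequence on `R` is thus weakly regular on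
`A`, and weak regularity passes to every submodule `N` of `A` with `N ∩ IA = IN` for all ideals `I`
of `R`: to `R`, by faithful flatness, and to the direct summand `J`.
-/

namespace NonNoethCM

universe u v w

section KoszulFunctoriality

variable {R : Type u} [CommRing R] {ℓ : ℕ} {x : Fin ℓ → R} {M : Type v} {N : Type w}
  [AddCommGroup M] [Module R M] [AddCommGroup N] [Module R N]

theorem koszulD_apply (z : Finset (Fin ℓ) → M) (s : Finset (Fin ℓ)) :
    koszulD x M z s = ∑ j ∈ sᶜ, sgn R s j • x j • z (insert j s) :=
  rfl

theorem koszulD_compLeft (φ : N →ₗ[R] M) (z : Finset (Fin ℓ) → N) :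
    koszulD x M (φ.compLeft _ z) = φ.compLeft _ (koszulD x N z) := by
  funext s
  simp [koszulD_apply]

theorem koszulPhi_compLeft (φ : N →ₗ[R] M) (n m : ℕ) (z : Finset (Fin ℓ) → N) :
    koszulPhi x M n m (φ.compLeft _ z) = φ.compLeft _ (koszulPhi x N n m z) := by
  funext s
  simp [koszulPhi]

theorem compLeft_mem_koszulChains (φ : N →ₗ[R] M) {i : ℕ} {z : Finset (Fin ℓ) → N}
    (hz : z ∈ koszulChains N x i) : φ.compLeft _ z ∈ koszulChains M x i := fun s hs => by
  simp [hz s hs]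

theorem compLeft_mem_koszulBoundaries (φ : N →ₗ[R] M) {i : ℕ} {z : Finset (Fin ℓ) → N}
    (hz : z ∈ koszulBoundaries x N i) : φ.compLeft _ z ∈ koszulBoundaries x M i := by
  obtain ⟨w, hw, rfl⟩ := hz
  exact ⟨φ.compLeft _ w, compLeft_mem_koszulChains φ hw, koszulD_compLeft φ w⟩

theorem koszulHomologyMap_eq_zero_iff {n m : ℕ} (h : n ≤ m) (i : ℕ) :
    koszulHomologyMap x M h i = 0 ↔
      koszulCycles (x ^ m) M i ≤ (koszulBoundaries (x ^ n) M i).comap (koszulPhi x M n m) := by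
  constructor
  · intro h0 z hz
    have hz0 := LinearMap.congr_fun h0 (Submodule.Quotient.mk ⟨z, hz⟩)
    exact (Submodule.Quotient.mk_eq_zero
      ((koszulBoundaries (x ^ n) M i).submoduleOf (koszulCycles (x ^ n) M i))).1 hz0
  · intro h0
    ext z
    exact (Submodule.Quotient.mk_eq_zero _).2 (h0 z.2)

end KoszulFunctoriality

section KoszulFlat

variable {R : Type u} [CommRing R] {ℓ : ℕ} {x : Fin ℓ → R} {M : Type v} [AddCommGroup M]
  [Module R M]

/-- The universal Koszul `i`-chain, with coefficients in the free module on the subsets of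
`{1, …, ℓ}`: every `i`-chain with coefficients in a module is its image under exactly one linear map
that vanishes on the basis vectors of the subsets not of size `i`. -/
def universalChain (R : Type u) [CommRing R] (ℓ i : ℕ) :
    Finset (Fin ℓ) → (Finset (Fin ℓ) → R) :=
  fun s => if s.card = i then Pi.single s 1 else 0

theorem universalChain_mem_koszulChains (i : ℕ) :
    universalChain R ℓ i ∈ koszulChains (Finset (Fin ℓ) → R) x i :=
  fun _ hs => if_neg hs

theorem compLeft_linearCombination_universalChain {i : ℕ} {z : Finset (Fin ℓ) → M}
    (hz : z ∈ koszulChains M x i) :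
    (Fintype.linearCombination R z).compLeft _ (universalChain R ℓ i) = z := by
  funext s
  by_cases hs : s.card = i
  · simp [universalChain, hs, Fintype.linearCombination_apply_single]
  · simp [universalChain, hs, hz s hs]

/-- By the equational criterion, the linear map classifying a cycle `z` factors through a finite
free module, in such a way that the universal chain already becomes a cycle there. -/
theorem koszulCycles_le_iSup_map_compLeft [Module.Flat R M] (i : ℕ) :
    koszulCycles x M i ≤ ⨆ φ : R →ₗ[R] M, (koszulCycles x R i).map (φ.compLeft _) := by
  rintro z ⟨hzi, hz⟩
  set e := universalChain R ℓ i
  set zBar := Fintype.linearCombination R z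
  have hze : zBar.compLeft _ e = z := compLeft_linearCombination_universalChain hzi
  have hrel : zBar ∘ₗ Fintype.linearCombination R (koszulD x _ e) = 0 := by
    ext s
    have h := congr_fun (koszulD_compLeft (x := x) zBar e) s
    rw [hze, LinearMap.mem_ker.1 hz] at h
    simpa [Fintype.linearCombination_apply_single] using h.symm
  obtain ⟨k, a, y, hya, ha⟩ := Module.Flat.exists_factorization_of_comp_eq_zero_of_free hrel
  have hae : koszulD x _ (a.compLeft _ e) = 0 := by
    funext s
    have h := LinearMap.congr_fun ha (Pi.single s 1)
    simpa [koszulD_compLeft, Fintype.linearCombination_apply_single] using h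
  have hz_sum : z = ∑ l, (y ∘ₗ Finsupp.lsingle l).compLeft _
      ((Finsupp.lapply l ∘ₗ a).compLeft _ e) := by
    rw [← hze, hya]
    funext s
    simp [← map_sum, Finsupp.univ_sum_single]
  rw [hz_sum]
  refine Submodule.sum_mem _ fun l _ => Submodule.mem_iSup_of_mem (y ∘ₗ Finsupp.lsingle l)
    (Submodule.mem_map_of_mem ⟨compLeft_mem_koszulChains _ (universalChain_mem_koszulChains i), ?_⟩)
  exact (koszulD_compLeft (Finsupp.lapply l) (a.compLeft _ e)).trans (by rw [hae, map_zero])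

theorem IsWeaklyProregular.of_flat [Module.Flat R M] (hx : IsWeaklyProregular x R) :
    IsWeaklyProregular x M := by
  intro n
  obtain ⟨m, hnm, hzero⟩ := hx n
  refine ⟨m, hnm, fun i hi => (koszulHomologyMap_eq_zero_iff hnm i).2 ?_⟩
  refine (koszulCycles_le_iSup_map_compLeft i).trans (iSup_le fun φ => ?_)
  rintro _ ⟨z, hz, rfl⟩
  rw [Submodule.mem_comap, koszulPhi_compLeft]
  exact compLeft_mem_koszulBoundaries φ ((koszulHomologyMap_eq_zero_iff hnm i).1 (hzero i hi) hz)

end KoszulFlat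

section KoszulAlgebraMap

variable {R : Type u} [CommRing R] {A : Type v} [CommRing A] [Algebra R A] {M : Type w}
  [AddCommGroup M] [Module R M] [Module A M] [IsScalarTower R A M] {ℓ : ℕ} {x : Fin ℓ → R}

theorem koszulD_algebraMap_comp (z : Finset (Fin ℓ) → M) :
    koszulD (algebraMap R A ∘ x) M z = koszulD x M z := by
  have hsgn (s : Finset (Fin ℓ)) (j : Fin ℓ) : sgn A s j = algebraMap R A (sgn R s j) := by
    simp [sgn]
  funext s
  simp [koszulD_apply, hsgn]

theorem koszulPhi_algebraMap_comp (n m : ℕ) (z : Finset (Fin ℓ) → M) :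
    koszulPhi (algebraMap R A ∘ x) M n m z = koszulPhi x M n m z := by
  funext s
  simp [koszulPhi, ← map_pow, ← map_prod]

theorem mem_koszulCycles_algebraMap_comp_iff {i : ℕ} {z : Finset (Fin ℓ) → M} :
    z ∈ koszulCycles (algebraMap R A ∘ x) M i ↔ z ∈ koszulCycles x M i := by
  simp only [koszulCycles, Submodule.mem_inf, LinearMap.mem_ker, koszulD_algebraMap_comp]
  rfl

theorem mem_koszulBoundaries_algebraMap_comp_iff {i : ℕ} {z : Finset (Fin ℓ) → M} :
    z ∈ koszulBoundaries (algebraMap R A ∘ x) M i ↔ z ∈ koszulBoundaries x M i := by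
  simp only [koszulBoundaries, Submodule.mem_map, koszulD_algebraMap_comp]
  rfl

theorem isWeaklyProregular_algebraMap_comp_iff :
    IsWeaklyProregular (algebraMap R A ∘ x) M ↔ IsWeaklyProregular x M := by
  have hpow (n : ℕ) : (algebraMap R A ∘ x) ^ n = algebraMap R A ∘ (x ^ n) := by
    funext j
    simp
  simp only [IsWeaklyProregular, koszulHomologyMap_eq_zero_iff, SetLike.le_def, hpow,
    Submodule.mem_comap, koszulPhi_algebraMap_comp, mem_koszulCycles_algebraMap_comp_iff,
    mem_koszulBoundaries_algebraMap_comp_iff]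

end KoszulAlgebraMap

section CechFraction

variable {R : Type u} [CommRing R] {ℓ : ℕ} (x : Fin ℓ → R) {M : Type v} [AddCommGroup M]
  [Module R M]

/-- The map `m ↦ m / (∏ j ∈ s, x j) ^ k` from `M` to its localization at the powers of
`∏ j ∈ s, x j`. -/
noncomputable def cechFraction (s : Finset (Fin ℓ)) (k : ℕ) : M →ₗ[R] CechPiece x M s where
  toFun m := IsLocalizedModule.mk' (LocalizedModule.mkLinearMap _ M) m
    (⟨(∏ j ∈ s, x j) ^ k, k, rfl⟩ : Submonoid.powers (∏ j ∈ s, x j))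
  map_add' _ _ := IsLocalizedModule.mk'_add _ _ _ _
  map_smul' _ _ := IsLocalizedModule.mk'_smul _ _ _ _

theorem cechFraction_eq_iff {s : Finset (Fin ℓ)} {k l : ℕ} {m m' : M} :
    cechFraction x s k m = cechFraction x s l m' ↔
      ∃ K, (∏ j ∈ s, x j) ^ (K + l) • m = (∏ j ∈ s, x j) ^ (K + k) • m' := by
  refine (IsLocalizedModule.mk'_eq_mk'_iff _ _ _ _ _).trans ?_
  simp [Subtype.exists, Submonoid.mem_powers_iff, Submonoid.smul_def, pow_add, mul_smul, eq_comm]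

theorem cechFraction_add_pow_smul (s : Finset (Fin ℓ)) (k l : ℕ) (m : M) :
    cechFraction x s (k + l) ((∏ j ∈ s, x j) ^ l • m) = cechFraction x s k m :=
  (cechFraction_eq_iff x).2 ⟨0, by simp only [smul_smul, ← pow_add, zero_add]⟩

theorem exists_cechFraction_eq {s : Finset (Fin ℓ)} (c : CechPiece x M s) :
    ∃ (k : ℕ) (m : M), cechFraction x s k m = c := by
  obtain ⟨⟨m, _, k, rfl⟩, h⟩ :=
    IsLocalizedModule.mk'_surjective (Submonoid.powers (∏ j ∈ s, x j))
      (LocalizedModule.mkLinearMap _ M) c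
  exact ⟨k, m, h⟩

theorem exists_forall_cechFraction_eq {ι : Type*} [Finite ι] {s : ι → Finset (Fin ℓ)}
    (c : ∀ i, CechPiece x M (s i)) :
    ∃ (N : ℕ) (m : ι → M), ∀ i, cechFraction x (s i) N (m i) = c i := by
  choose k m h using fun i => exists_cechFraction_eq x (c i)
  obtain ⟨N, hN⟩ := Finite.bddAbove_range k
  refine ⟨N, fun i => (∏ j ∈ s i, x j) ^ (N - k i) • m i, fun i => ?_⟩
  rw [← h i, ← cechFraction_add_pow_smul x (s i) (k i) (N - k i) (m i),
    Nat.add_sub_cancel' (hN ⟨i, rfl⟩)]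

theorem pow_smul_cechFraction (s : Finset (Fin ℓ)) (k : ℕ) (m : M) :
    (∏ j ∈ s, x j) ^ k • cechFraction x s k m = LocalizedModule.mkLinearMap _ M m :=
  IsLocalizedModule.mk'_cancel' _ m
    (⟨(∏ j ∈ s, x j) ^ k, k, rfl⟩ : Submonoid.powers (∏ j ∈ s, x j))

theorem cechRes_cechFraction {s t : Finset (Fin ℓ)} (h : s ⊆ t) (k : ℕ) (m : M) :
    cechRes x M h (cechFraction x s k m) =
      cechFraction x t k ((∏ j ∈ t \ s, x j) ^ k • m) := by
  refine ((Module.End.isUnit_iff _).1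
    (isUnit_of_mem_powers x M h ⟨(∏ j ∈ s, x j) ^ k, k, rfl⟩)).1 ?_
  change (∏ j ∈ s, x j) ^ k • cechRes x M h (cechFraction x s k m) =
    (∏ j ∈ s, x j) ^ k • cechFraction x t k ((∏ j ∈ t \ s, x j) ^ k • m)
  rw [← map_smul, pow_smul_cechFraction, ← map_smul, smul_smul, ← mul_pow, mul_comm,
    Finset.prod_sdiff h, map_smul, pow_smul_cechFraction]
  exact LinearMap.congr_fun (LocalizedModule.lift_comp _ _ (isUnit_of_mem_powers x M h)) m

end CechFraction

section TopCech

variable {R : Type u} [CommRing R] {ℓ : ℕ} {x : Fin ℓ → R} {M : Type v} [AddCommGroup M]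
  [Module R M]

theorem eq_single_univ_of_mem_cechCochains {c : ∀ s, CechPiece x M s}
    (hc : c ∈ cechCochains x M ℓ) : c = Pi.single Finset.univ (c Finset.univ) := by
  funext t
  by_cases ht : t = Finset.univ
  · subst ht
    rw [Pi.single_eq_same]
  · rw [Pi.single_eq_of_ne ht]
    exact hc t fun h => ht (Finset.eq_univ_of_card _ (by simpa using h))

theorem single_univ_mem_cechCocycles (a : CechPiece x M Finset.univ) :
    Pi.single Finset.univ a ∈ cechCocycles x M ℓ := by
  refine ⟨fun s hs => Pi.single_eq_of_ne (by rintro rfl; simp at hs) _, ?_⟩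
  refine LinearMap.mem_ker.2 (funext fun t => ?_)
  rw [cechD_apply]
  refine Finset.sum_eq_zero fun j _ => ?_
  have ht : t.erase j ≠ Finset.univ := fun h => Finset.notMem_erase j t (h ▸ Finset.mem_univ j)
  rw [Pi.single_eq_of_ne ht, map_zero, smul_zero]

theorem cechD_single_univ_erase (j : Fin ℓ) (u : CechPiece x M (Finset.univ.erase j)) :
    cechD x M (Pi.single (Finset.univ.erase j) u) =
      Pi.single Finset.univ (sgn R Finset.univ j • cechRes x M (Finset.erase_subset j _) u) := by
  funext t
  rw [cechD_apply]
  by_cases ht : t = Finset.univ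
  · subst ht
    rw [Finset.sum_eq_single_of_mem j (Finset.mem_univ j), Pi.single_eq_same, Pi.single_eq_same]
    intro i _ hij
    rw [Pi.single_eq_of_ne, map_zero, smul_zero]
    exact fun h => hij (Finset.erase_injOn _ (Finset.mem_univ i) (Finset.mem_univ j) h)
  · rw [Pi.single_eq_of_ne ht]
    refine Finset.sum_eq_zero fun i hi => ?_
    rw [Pi.single_eq_of_ne, map_zero, smul_zero]
    intro h
    have hcard := congrArg Finset.card h
    rw [Finset.card_erase_of_mem hi, Finset.card_erase_of_mem (Finset.mem_univ j)] at hcard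
    have hlt := Finset.card_lt_card (Finset.ssubset_univ_iff.2 ht)
    have hpos := Finset.card_pos.2 ⟨i, hi⟩
    omega

theorem single_univ_mem_cechCoboundaries_iff {a : CechPiece x M Finset.univ} :
    Pi.single Finset.univ a ∈ cechCoboundaries x M ℓ ↔
      ∃ u : ∀ j, CechPiece x M (Finset.univ.erase j),
        a = ∑ j, cechRes x M (Finset.erase_subset j _) (u j) := by
  cases ℓ with
  | zero => simp [cechCoboundaries]
  | succ ℓ =>
    constructor
    · rintro ⟨w, -, hw⟩
      refine ⟨fun j => sgn R Finset.univ j • w (Finset.univ.erase j), ?_⟩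
      have hw_univ := congr_fun hw Finset.univ
      rw [Pi.single_eq_same, cechD_apply] at hw_univ
      simp only [← hw_univ, map_smul]
    · rintro ⟨u, rfl⟩
      have hsgn (j : Fin (ℓ + 1)) : sgn R Finset.univ j * sgn R Finset.univ j = 1 := by
        rw [sgn, ← mul_pow, neg_one_mul, neg_neg, one_pow]
      refine ⟨∑ j, Pi.single (Finset.univ.erase j) (sgn R Finset.univ j • u j),
        Submodule.sum_mem _ fun j _ s hs => Pi.single_eq_of_ne (by rintro rfl; simp at hs) _, ?_⟩
      simp only [map_sum, cechD_single_univ_erase, map_smul, smul_smul, hsgn, one_smul]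
      exact (map_sum (LinearMap.single R (CechPiece x M) Finset.univ) _ _).symm

theorem single_univ_cechFraction_mem_cechCoboundaries_iff {n : ℕ} {m : M} :
    Pi.single Finset.univ (cechFraction x Finset.univ n m) ∈ cechCoboundaries x M ℓ ↔
      ∃ (k : ℕ) (b : Fin ℓ → M), (∏ j, x j) ^ k • m = ∑ j, x j ^ (n + k) • b j := by
  have hres (k : ℕ) (j : Fin ℓ) (b : M) : cechRes x M (Finset.erase_subset j Finset.univ)
      (cechFraction x _ k b) = cechFraction x Finset.univ k (x j ^ k • b) := by
    rw [cechRes_cechFraction, Finset.sdiff_erase (Finset.mem_univ j)]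
    simp
  rw [single_univ_mem_cechCoboundaries_iff]
  constructor
  · rintro ⟨u, hu⟩
    obtain ⟨N, a, ha⟩ := exists_forall_cechFraction_eq x u
    simp only [← ha, hres, ← map_sum] at hu
    obtain ⟨K, hK⟩ := (cechFraction_eq_iff x).1 hu
    refine ⟨K + N, fun j => (∏ i ∈ Finset.univ.erase j, x i) ^ (K + n) • a j, ?_⟩
    rw [hK, Finset.smul_sum]
    refine Finset.sum_congr rfl fun j _ => ?_
    rw [smul_smul, smul_smul, ← Finset.mul_prod_erase Finset.univ x (Finset.mem_univ j)]
    congr 1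
    ring
  · rintro ⟨k, b, hb⟩
    refine ⟨fun j => cechFraction x _ (n + k) (b j), ?_⟩
    simp only [hres, ← map_sum, ← hb, cechFraction_add_pow_smul]

variable (x M) in
/-- The map sending `m` to the class of `m / (x₁ ⋯ x_ℓ) ^ n` in the top Čech cohomology of `M`. -/
noncomputable def topCechClass (n : ℕ) : M →ₗ[R] CechCohomology x M ℓ :=
  Submodule.mkQ _ ∘ₗ
    (LinearMap.single R (CechPiece x M) Finset.univ ∘ₗ cechFraction x Finset.univ n).codRestrict
      (cechCocycles x M ℓ) fun _ => single_univ_mem_cechCocycles _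

theorem mem_ker_topCechClass_iff {n : ℕ} {m : M} :
    m ∈ LinearMap.ker (topCechClass x M n) ↔
      ∃ (k : ℕ) (b : Fin ℓ → M), (∏ j, x j) ^ k • m = ∑ j, x j ^ (n + k) • b j :=
  (Submodule.Quotient.mk_eq_zero _).trans single_univ_cechFraction_mem_cechCoboundaries_iff

theorem exists_topCechClass_eq (η : CechCohomology x M ℓ) :
    ∃ (n : ℕ) (m : M), topCechClass x M n m = η := by
  obtain ⟨c, rfl⟩ := Submodule.Quotient.mk_surjective _ η
  obtain ⟨n, m, hm⟩ := exists_cechFraction_eq x (c.1 Finset.univ)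
  refine ⟨n, m, congrArg Submodule.Quotient.mk (Subtype.ext ?_)⟩
  rw [eq_single_univ_of_mem_cechCochains c.2.1, ← hm]
  rfl

theorem nontrivial_localizedModule_cechCohomology_iff (p : Ideal R) [p.IsPrime] :
    Nontrivial (LocalizedModule p.primeCompl (CechCohomology x R ℓ)) ↔
      ∃ n, LinearMap.ker (topCechClass x R n) ≤ p := by
  rw [← not_subsingleton_iff_nontrivial, LocalizedModule.subsingleton_iff]
  push Not
  constructor
  · rintro ⟨η, hη⟩
    obtain ⟨n, m, rfl⟩ := exists_topCechClass_eq η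
    refine ⟨n, fun s hs => not_not.1 fun hsp => hη s hsp ?_⟩
    rw [← map_smul, smul_eq_mul, mul_comm, ← smul_eq_mul, map_smul, LinearMap.mem_ker.1 hs,
      smul_zero]
  · rintro ⟨n, hn⟩
    refine ⟨topCechClass x R n 1, fun s hsp hs => hsp (hn ?_)⟩
    rwa [← map_smul, smul_eq_mul, mul_one] at hs

end TopCech

section TopCechFlat

variable {R : Type u} [CommRing R] {A : Type v} [CommRing A] [Algebra R A] [Module.Flat R A]
  {ℓ : ℕ} (x : Fin ℓ → R)

theorem ker_topCechClass_algebraMap_comp (n : ℕ) :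
    LinearMap.ker (topCechClass (algebraMap R A ∘ x) A n) =
      Ideal.map (algebraMap R A) (LinearMap.ker (topCechClass x R n)) := by
  refine le_antisymm (fun s hs => ?_) (Ideal.map_le_iff_le_comap.2 fun s hs => ?_)
  · obtain ⟨k, b, hb⟩ := mem_ker_topCechClass_iff.1 hs
    let coeff (o : Option (Fin ℓ)) : R := o.elim ((∏ j, x j) ^ k) fun j => -x j ^ (n + k)
    let val (o : Option (Fin ℓ)) : A := o.elim s b
    have hrel : ∑ o, coeff o • val o = 0 := by
      simpa [coeff, val, Fintype.sum_option, Algebra.smul_def, ← sub_eq_add_neg, sub_eq_zero]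
        using hb
    obtain ⟨r, c, d, hs_eq, hc⟩ :=
      Module.Flat.isTrivialRelation_of_sum_smul_eq_zero (M := A) (f := coeff) (x := val) hrel
    rw [show s = ∑ i, c none i • d i from hs_eq none]
    refine Ideal.sum_mem _ fun i _ => ?_
    rw [Algebra.smul_def]
    refine Ideal.mul_mem_right _ _ (Ideal.mem_map_of_mem _ (mem_ker_topCechClass_iff.2
      ⟨k, fun j => c (some j) i, ?_⟩))
    simpa [coeff, Fintype.sum_option, ← sub_eq_add_neg, sub_eq_zero] using hc i
  · obtain ⟨k, b, hb⟩ := mem_ker_topCechClass_iff.1 hs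
    rw [Ideal.mem_comap, mem_ker_topCechClass_iff]
    refine ⟨k, algebraMap R A ∘ b, ?_⟩
    have hb_map := congrArg (algebraMap R A) hb
    simp only [smul_eq_mul, map_mul, map_sum, map_pow, map_prod] at hb_map
    exact hb_map

theorem nontrivial_localizedModule_cechCohomology_algebraMap_comp_iff (P : Ideal A) [P.IsPrime] :
    Nontrivial (LocalizedModule P.primeCompl (CechCohomology (algebraMap R A ∘ x) A ℓ)) ↔
      Nontrivial (LocalizedModule (P.comap (algebraMap R A)).primeCompl
        (CechCohomology x R ℓ)) := by
  simp only [nontrivial_localizedModule_cechCohomology_iff, ker_topCechClass_algebraMap_comp,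
    Ideal.map_le_iff_le_comap]

end TopCechFlat

section FaithfullyFlat

variable {R : Type u} [CommRing R] {A : Type v} [CommRing A] [Algebra R A]

theorem get_map_iff {α : Type u} {β : Type v} (C : ∀ ℓ, (Fin ℓ → β) → Prop) (f : α → β)
    (x : List α) : C (x.map f).length (x.map f).get ↔ C x.length (f ∘ x.get) := by
  have h : (⟨_, (x.map f).get⟩ : Σ ℓ, Fin ℓ → β) = ⟨_, f ∘ x.get⟩ :=
    List.equivSigmaTuple.symm.injective (by simp [List.equivSigmaTuple, List.map_ofFn.symm])
  exact iff_of_eq (congrArg (fun y : Σ ℓ, Fin ℓ → β => C y.1 y.2) h)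

theorem mem_support_quotient_ofList_smul_top_iff {x : List R} {p : PrimeSpectrum R} :
    p ∈ Module.support R (R ⧸ (Ideal.ofList x • ⊤ : Submodule R R)) ↔
      Ideal.ofList x ≤ p.asIdeal := by
  rw [smul_eq_mul, Ideal.mul_top, Module.support_eq_zeroLocus, Ideal.annihilator_quotient]
  rfl

theorem IsParameterSequence.map_algebraMap [Module.FaithfullyFlat R A] {x : List R}
    (hx : IsParameterSequence R x) : IsParameterSequence A (x.map (algebraMap R A)) := by
  rcases hx with rfl | ⟨hproregular, hne, hcech⟩
  · exact Or.inl rfl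
  refine Or.inr ⟨?_, fun htop => hne ?_, fun P hP => ?_⟩
  · rw [get_map_iff (fun _ y => IsWeaklyProregular y A), isWeaklyProregular_algebraMap_comp_iff]
    exact hproregular.of_flat
  · rw [smul_eq_mul, Ideal.mul_top] at htop ⊢
    rw [← Ideal.comap_map_eq_self_of_faithfullyFlat (B := A) (Ideal.ofList x), Ideal.map_ofList,
      htop, Ideal.comap_top]
  · refine (get_map_iff (fun ℓ (y : Fin ℓ → A) => Nontrivial (LocalizedModule P.asIdeal.primeCompl
      (CechCohomology y A ℓ))) _ _).2 ?_
    rw [nontrivial_localizedModule_cechCohomology_algebraMap_comp_iff]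
    refine hcech (P.comap (algebraMap R A)) (mem_support_quotient_ofList_smul_top_iff.2 ?_)
    rw [mem_support_quotient_ofList_smul_top_iff, ← Ideal.map_ofList] at hP
    exact Ideal.map_le_iff_le_comap.1 hP

theorem IsStrongParameterSequence.map_algebraMap [Module.FaithfullyFlat R A] {x : List R}
    (hx : IsStrongParameterSequence R x) :
    IsStrongParameterSequence A (x.map (algebraMap R A)) := by
  intro i hi hix
  rw [← List.map_take]
  exact (hx i hi (by simpa using hix)).map_algebraMap

theorem IsStrongParameterSequence.isRegularSequence {N : Type w} [AddCommGroup N] [Module R N]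
    {x : List R} (hx : IsStrongParameterSequence N x)
    (hreg : RingTheory.Sequence.IsWeaklyRegular N x) : IsRegularSequence N x := by
  refine or_iff_not_imp_left.2 fun hne => ⟨hreg, ?_⟩
  have hparam := hx x.length (List.length_pos_iff.2 hne) le_rfl
  rw [List.take_length] at hparam
  exact (hparam.resolve_left hne).2.1.symm

theorem isWeaklyRegular_of_comap_smul_top_le {M : Type v} {N : Type w} [AddCommGroup M]
    [Module R M] [AddCommGroup N] [Module R N] (ι : N →ₗ[R] M)
    (hι : ∀ I : Ideal R, (I • ⊤ : Submodule R M).comap ι ≤ I • ⊤) {x : List R}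
    (hx : RingTheory.Sequence.IsWeaklyRegular M x) :
    RingTheory.Sequence.IsWeaklyRegular N x := by
  refine ⟨fun i hi => ?_⟩
  have hreg := hx.regular_mod_prev i hi
  rw [isSMulRegular_quotient_iff_mem_of_smul_mem] at hreg ⊢
  intro n hn
  refine hι _ (hreg _ ?_)
  rw [← map_smul]
  exact Submodule.smul_top_le_comap_smul_top _ ι hn

theorem IsCohenMacaulayRing.isWeaklyRegular [Module.FaithfullyFlat R A]
    (hA : IsCohenMacaulayRing A) {x : List R} (hx : IsStrongParameterSequence R x) :
    RingTheory.Sequence.IsWeaklyRegular A x := by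
  rw [← RingTheory.Sequence.isWeaklyRegular_map_algebraMap_iff A A x]
  rcases hA _ hx.map_algebraMap with hnil | hreg
  · simp [hnil]
  · exact hreg.toIsWeaklyRegular

theorem IsCohenMacaulayRing.of_faithfullyFlat [Module.FaithfullyFlat R A]
    (hA : IsCohenMacaulayRing A) : IsCohenMacaulayRing R := fun x hx =>
  hx.isRegularSequence <| isWeaklyRegular_of_comap_smul_top_le (Algebra.linearMap R A)
    (fun I => by
      rw [Ideal.smul_top_eq_map, smul_eq_mul, Ideal.mul_top]
      exact (Ideal.comap_map_eq_self_of_faithfullyFlat I).le)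
    (hA.isWeaklyRegular hx)

theorem IsCohenMacaulayRing.isCohenMacaulayModule_of_retract [Module.FaithfullyFlat R A]
    (hA : IsCohenMacaulayRing A) {N : Type w} [AddCommGroup N] [Module R N] (ι : N →ₗ[R] A)
    (ρ : A →ₗ[R] N) (hρι : ρ ∘ₗ ι = LinearMap.id)
    (hN : ∀ x : List R, IsStrongParameterSequence N x → IsStrongParameterSequence R x) :
    IsCohenMacaulayModule R N := fun x hx =>
  hx.isRegularSequence <| isWeaklyRegular_of_comap_smul_top_le ι
    (fun I n hn => by
      have hρ := Submodule.smul_top_le_comap_smul_top I ρ hn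
      rwa [Submodule.mem_comap, ← LinearMap.comp_apply, hρι] at hρ)
    (hA.isWeaklyRegular (hN x hx))

end FaithfullyFlat

section Product

open TensorProduct (prodLeft)

variable {R : Type u} [CommRing R] {M : Type v} {N : Type w} [AddCommGroup M] [Module R M]
  [AddCommGroup N] [Module R N]

theorem flat_prod [Module.Flat R M] [Module.Flat R N] : Module.Flat R (M × N) := by
  refine Module.Flat.iff_lTensor_preserves_injective_linearMap.2 fun P Q _ _ _ _ g hg => ?_
  have hcomm : (prodLeft R R M N Q).toLinearMap ∘ₗ g.lTensor (M × N) =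
      (g.lTensor M).prodMap (g.lTensor N) ∘ₗ (prodLeft R R M N P).toLinearMap :=
    TensorProduct.ext' fun _ _ => rfl
  refine Function.Injective.of_comp (f := prodLeft R R M N Q) ?_
  rw [← LinearEquiv.coe_coe, ← LinearMap.coe_comp, hcomm]
  exact ((Module.Flat.lTensor_preserves_injective_linearMap g hg).prodMap
    (Module.Flat.lTensor_preserves_injective_linearMap g hg)).comp (prodLeft R R M N P).injective

theorem faithfullyFlat_prod [Module.FaithfullyFlat R M] [Module.Flat R N] :
    Module.FaithfullyFlat R (M × N) :=
  (Module.FaithfullyFlat.iff_flat_and_lTensor_faithful R (M × N)).2 ⟨flat_prod, fun P _ _ _ =>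
    have := Module.FaithfullyFlat.lTensor_nontrivial R M P
    (prodLeft R R M N P).toEquiv.nontrivial⟩

end Product

section Amalgamation

variable {R : Type u} {S : Type v} [CommRing R] [CommRing S] (f : R →+* S) (J : Ideal S)

/-- The embedding `r ↦ (r, f r)` of `R` in the amalgamation, through which the amalgamation is an
`R`-algebra. -/
def amalgamationEmbedding : R →+* amalgamation f J :=
  ((RingHom.id R).prod f).codRestrict (amalgamation f J) fun r => ⟨r, 0, J.zero_mem, by simp⟩

instance : Algebra R (amalgamation f J) := (amalgamationEmbedding f J).toAlgebra

/-- The `R`-linear isomorphism `(r, j) ↦ (r, f r + j)` from `R ⊕ J` to the amalgamation, where `R`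
acts on `J` through `f`. -/
def amalgamationEquiv :
    letI : Module R J := Module.compHom J f
    (R × J) ≃ₗ[R] amalgamation f J :=
  letI : Module R J := Module.compHom J f
  { toFun := fun a => ⟨(a.1, f a.1 + a.2), a.1, a.2, a.2.2, rfl⟩
    invFun := fun a => (a.1.1, ⟨a.1.2 - f a.1.1, by obtain ⟨_, r, j, hj, rfl⟩ := a; simpa using hj⟩)
    left_inv := fun a => by simp
    right_inv := fun a => by simp
    map_add' := fun a b => Subtype.ext (Prod.ext rfl (by simp; ring))
    map_smul' := fun r a => Subtype.ext (Prod.ext rfl (by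
      change f (r * a.1) + f r * a.2 = f r * (f a.1 + a.2)
      rw [map_mul, mul_add])) }

end Amalgamation

end NonNoethCM

theorem mainTheorem11 {R : Type*} {S : Type*} [CommRing R] [CommRing S]
    (f : R →+* S) (J : Ideal S) :
    -- `J` is regarded as an `R`-module through `f`
    letI : Module R J := Module.compHom J f
    Module.Flat R J → NonNoethCM.IsCohenMacaulayRing (NonNoethCM.amalgamation f J) →
      NonNoethCM.IsCohenMacaulayRing R ∧
        ((∀ x : List R, NonNoethCM.IsStrongParameterSequence J x →
            NonNoethCM.IsStrongParameterSequence R x) →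
          NonNoethCM.IsCohenMacaulayModule R J) := by
  let _ : Module R J := Module.compHom J f
  intro hflat hCM
  let e : (R × J) ≃ₗ[R] NonNoethCM.amalgamation f J := NonNoethCM.amalgamationEquiv f J
  have : Module.FaithfullyFlat R (R × J) := NonNoethCM.faithfullyFlat_prod
  have : Module.FaithfullyFlat R (NonNoethCM.amalgamation f J) := .of_linearEquiv R (R × J) e.symm
  refine ⟨hCM.of_faithfullyFlat, hCM.isCohenMacaulayModule_of_retract
    (e.toLinearMap ∘ₗ LinearMap.inr R R J) (LinearMap.snd R R J ∘ₗ e.symm.toLinearMap) ?_⟩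
  ext j
  simp
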